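/- Let $P$ be a polygon in the plane, possibly with holes: the closed region bounded by a simple closed polygonal curve, minus the open interiors of finitely many pairwise disjoint simple polygons (the holes) lying strictly inside that curve. Suppose that $P$ is not convex. A diagonal of $P$ is a segment between two vertices of $P$ that lies in $P$. Suppose $P$ is decomposed by diagonals into $C$ convex pieces: non-overlapping convex polygons whose union is $P$, such that every edge of a piece is an edge or a diagonal of $P$ and every edge of $P$ is an edge of exactly one piece. Two points of $P$ are $k$-visible to each other if the segment between them crosses at most $k$ edges of $P$. (The two endpoints count as lying on the inner side of the boundary, so a segment that starts on an edge crosses that edge exactly when it leaves $P$ there; passing through a vertex between the interior and the exterior counts as crossing one edge; merely touching the boundary is not a crossing.) Then for every even $k \ge 2$ there is a set $G$ of at most $kC$ distinct points (guards) on the edges of $P$ that $(k+2)$-guards $P$ under $k$-visibility, i.e. every point of $P$ is $k$-visible from at least $k+2$ guards of $G$. -/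

import Mathlib

namespace KVis

/-- The Euclidean plane. -/
abbrev Plane : Type := EuclideanSpace ℝ (Fin 2)

/-- The closed polygonal curve through the vertices of `Q` is simple: there are at least three
vertices, they are distinct, consecutive edges meet only in their common vertex, and any two other
edges are disjoint.  (Angles of 180 degrees are allowed.) -/
structure IsSimple {n : ℕ} (Q : Polygon Plane n) : Prop where
  three_le : 3 ≤ n
  injective : Function.Injective Q.vertices
  consecutive : ∀ i : Fin n,
    Q.edgeSet ℝ i ∩ Q.edgeSet ℝ (finRotate n i) = {Q.vertices (finRotate n i)}
  nonconsecutive : ∀ i j : Fin n, j ≠ i → j ≠ finRotate n i → i ≠ finRotate n j →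
    Disjoint (Q.edgeSet ℝ i) (Q.edgeSet ℝ j)

/-- The set of edges of a polygonal curve, each edge being a closed line segment. -/
def edges {n : ℕ} (Q : Polygon Plane n) : Set (Set Plane) :=
  Set.range fun i : Fin n => Q.edgeSet ℝ i

/-- The open inside of a closed polygonal curve: the points off the curve that lie in a bounded
connected component of the complement of the curve. -/
def inside {n : ℕ} (Q : Polygon Plane n) : Set Plane :=
  {x | x ∉ Q.boundary ℝ ∧ Bornology.IsBounded (connectedComponentIn (Q.boundary ℝ)ᶜ x)}

/-- The closed region bounded by a closed polygonal curve. -/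
def closedRegion {n : ℕ} (Q : Polygon Plane n) : Set Plane :=
  Q.boundary ℝ ∪ inside Q

/-- A polygon in the plane, possibly with holes (`holeCount = 0` gives a simple polygon).  The
holes are simple polygons that lie, boundary included, in the open inside of the outer curve, and
they are pairwise disjoint. -/
structure HoledPolygon where
  outerSize : ℕ
  outer : Polygon Plane outerSize
  outer_simple : IsSimple outer
  holeCount : ℕ
  holeSize : Fin holeCount → ℕ
  hole : ∀ j, Polygon Plane (holeSize j)
  hole_simple : ∀ j, IsSimple (hole j)
  hole_subset : ∀ j, closedRegion (hole j) ⊆ inside outer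
  holes_disjoint : ∀ i j, i ≠ j → Disjoint (closedRegion (hole i)) (closedRegion (hole j))

namespace HoledPolygon

variable (P : HoledPolygon)

/-- The polygon as a closed set of points: the region of the outer curve without the open insides
of the holes. -/
def region : Set Plane :=
  closedRegion P.outer \ ⋃ j, inside (P.hole j)

/-- The vertices, of the outer curve and of the holes. -/
def vertices : Set Plane :=
  Set.range P.outer.vertices ∪ ⋃ j, Set.range (P.hole j).vertices

/-- The edges ("real edges"), of the outer curve and of the holes. -/
def edges : Set (Set Plane) :=
  KVis.edges P.outer ∪ ⋃ j, KVis.edges (P.hole j)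

/-- A diagonal: a line segment between two vertices that lies entirely within the polygon. -/
def IsDiagonal (d : Set Plane) : Prop :=
  ∃ a ∈ P.vertices, ∃ b ∈ P.vertices, a ≠ b ∧ d = segment ℝ a b ∧ d ⊆ P.region

/-- For points `x`, `y` of the polygon: the line segment from `x` to `y` crosses at most `k` edges.
That is, there are at most `k` edges such that, along the segment, every passage between the polygon
and its exterior takes place on one of them.  The two end points count as being on the inner side of
the boundary, so that a segment that starts on an edge crosses this edge if and only if it leaves
the polygon there.  Passing from the interior to the exterior through a vertex counts as crossing
one edge, and merely touching the boundary counts as no crossing.  No edge can serve for two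
crossings, because an edge is a convex subset of the boundary. -/
def KVisible (k : ℕ) (x y : Plane) : Prop :=
  ∃ F : Set (Set Plane), F ⊆ P.edges ∧ F.encard ≤ k ∧
    ∀ s ∈ Set.Icc (0 : ℝ) 1, ∀ t ∈ Set.Icc (0 : ℝ) 1,
      (s = 0 ∨ s = 1 ∨ AffineMap.lineMap x y s ∈ interior P.region) →
      (AffineMap.lineMap x y t : Plane) ∉ P.region →
      ∃ u ∈ Set.uIcc s t, ∃ e ∈ F, (AffineMap.lineMap x y u : Plane) ∈ e

/-- `G` is a set of guards on edges of the polygon that `M`-guards it under `k`-visibility: every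
point of the polygon is `k`-visible from at least `M` different guards. -/
def MGuards (M k : ℕ) (G : Finset Plane) : Prop :=
  (∀ g ∈ G, ∃ e ∈ P.edges, g ∈ e) ∧
    ∀ x ∈ P.region, (M : ℕ∞) ≤ {g : Plane | g ∈ G ∧ P.KVisible k g x}.encard

/-- A decomposition of `P` by diagonals into `C` convex pieces: the pieces are convex polygons, they
do not overlap, they fill `P`, each edge of a piece is an edge or a diagonal of `P`, and each edge
of `P` is an edge of exactly one piece. -/
structure ConvexDecomposition (C : ℕ) where
  size : Fin C → ℕ
  piece : ∀ i, Polygon Plane (size i)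
  simple : ∀ i, IsSimple (piece i)
  convex : ∀ i, Convex ℝ (closedRegion (piece i))
  edge_or_diagonal : ∀ i, ∀ e ∈ KVis.edges (piece i), e ∈ P.edges ∨ P.IsDiagonal e
  edge_unique : ∀ e ∈ P.edges, ∃! i, e ∈ KVis.edges (piece i)
  nonoverlapping : ∀ i j, i ≠ j → Disjoint (inside (piece i)) (inside (piece j))
  cover : ⋃ i, closedRegion (piece i) = P.region

end HoledPolygon

end KVis

open Set

/-! ### Simple closed polygonal curves and the regions they bound -/

namespace KVis

/-! Every piece with real edges (edges of `P` itself) receives a group of `k` guards, all on one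
such edge and very close to one of its ends, the corner. The corner is the point of the piece's real
edges that is extreme for a generic linear functional. It suffices that every point `x` sees all
guards of two groups, since `k + k ≥ k + 2`.

A point in a piece sees that piece's group by convexity. A point near a corner also sees the group,
since only the edges at that vertex, at most two, can intervene. For the other groups two facts are
combined.

Blocking: if `x` does not see a point of the piece `B`, the segment leaves `P`, returns to its
interior and leaves again, because otherwise the first edges met from the two ends account for every
crossing. Such a pattern yields a piece other than `B` with a real edge on the way, in front of `B`
as seen from `x`. One further piece `A` may be excluded as blocker: two edges of `A` on both sides
of an exterior point would contradict convexity (`exists_inFront_of_not_kVisible`).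

Ordering: around `x`, "in front of" may be cyclic, but disjoint convex sets within an open half
plane bounded by a line through `x` have a frontmost member (`exists_forall_not_inFront`). The line
must not separate the guards of a group. Among `C + 1` nearly equal slopes one is suitable by
pigeonhole, since a group far from `x` spoils at most one (`exists_slope`). Extremality of the
corners closes the family: a piece with a real edge reaching into the low side has its corner there,
hence also its guards. If no corner lies on the low side, all groups lie on the high side.

A frontmost piece then has all its guards visible. Applied with one visible group excluded, this
gives a second one. Non-convexity of `P` ensures that real edges remain outside any single piece. -/

theorem isCompact_edgeSet {n : ℕ} (Q : Polygon Plane n) (i : Fin n) :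
    IsCompact (Q.edgeSet ℝ i) := by
  rw [Polygon.edgeSet_eq_image_edgePath]
  exact isCompact_Icc.image AffineMap.lineMap_continuous

theorem isClosed_boundary {n : ℕ} (Q : Polygon Plane n) : IsClosed (Q.boundary ℝ) :=
  isClosed_iUnion_of_finite fun i => (isCompact_edgeSet Q i).isClosed

theorem sUnion_edges {n : ℕ} (Q : Polygon Plane n) : ⋃₀ edges Q = Q.boundary ℝ :=
  sUnion_range _

theorem mem_inside_of_isPreconnected {n : ℕ} {Q : Polygon Plane n} {s : Set Plane}
    (hs : IsPreconnected s) (hd : Disjoint s (Q.boundary ℝ)) {x y : Plane} (hx : x ∈ s)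
    (hy : y ∈ s) (h : x ∈ inside Q) : y ∈ inside Q := by
  have hsub : s ⊆ (Q.boundary ℝ)ᶜ := hd.subset_compl_right
  refine ⟨hsub hy, ?_⟩
  rw [← connectedComponentIn_eq (hs.subset_connectedComponentIn hx hsub hy)]
  exact h.2

theorem exists_ball_disjoint_boundary {n : ℕ} (Q : Polygon Plane n) {x : Plane}
    (hx : x ∉ Q.boundary ℝ) : ∃ r > 0, Disjoint (Metric.ball x r) (Q.boundary ℝ) := by
  obtain ⟨r, hr, h⟩ := Metric.isOpen_iff.1 (isClosed_boundary Q).isOpen_compl x hx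
  exact ⟨r, hr, disjoint_left.2 h⟩

theorem isOpen_inside {n : ℕ} (Q : Polygon Plane n) : IsOpen (inside Q) := by
  refine Metric.isOpen_iff.2 fun x hx => ?_
  obtain ⟨r, hr, h⟩ := exists_ball_disjoint_boundary Q hx.1
  exact ⟨r, hr, fun y hy => mem_inside_of_isPreconnected (convex_ball x r).isPreconnected h
    (Metric.mem_ball_self hr) hy hx⟩

theorem isClosed_closedRegion {n : ℕ} (Q : Polygon Plane n) : IsClosed (closedRegion Q) := by
  rw [← isOpen_compl_iff]
  refine Metric.isOpen_iff.2 fun x hx => ?_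
  simp only [closedRegion, mem_compl_iff, mem_union, not_or] at hx
  obtain ⟨r, hr, h⟩ := exists_ball_disjoint_boundary Q hx.1
  refine ⟨r, hr, fun y hy => ?_⟩
  simp only [closedRegion, mem_compl_iff, mem_union, not_or]
  exact ⟨disjoint_left.1 h hy, fun hy' => hx.2 (mem_inside_of_isPreconnected
    (convex_ball x r).isPreconnected h hy (Metric.mem_ball_self hr) hy')⟩

theorem edge_subset_closedRegion {n : ℕ} {Q : Polygon Plane n} {e : Set Plane}
    (he : e ∈ edges Q) : e ⊆ closedRegion Q :=
  fun _ hx => Or.inl (sUnion_edges Q ▸ mem_sUnion_of_mem hx he)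

theorem volume_edgeSet {n : ℕ} (Q : Polygon Plane n) (i : Fin n) :
    MeasureTheory.volume (Q.edgeSet ℝ i) = 0 := by
  have hsub : Q.edgeSet ℝ i ⊆ line[ℝ, Q.vertices i, Q.vertices (finRotate n i)] := by
    rintro _ ⟨t, -, rfl⟩
    exact AffineMap.lineMap_mem_affineSpan_pair _ _ _
  refine MeasureTheory.measure_mono_null hsub
    (MeasureTheory.Measure.addHaar_affineSubspace _ _ fun h => ?_)
  have h1 := collinear_pair ℝ (Q.vertices i) (Q.vertices (finRotate n i))
  rw [collinear_iff_finrank_le_one, ← direction_affineSpan, h, AffineSubspace.direction_top,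
    finrank_top, finrank_euclideanSpace_fin] at h1
  omega

theorem volume_boundary {n : ℕ} (Q : Polygon Plane n) :
    MeasureTheory.volume (Q.boundary ℝ) = 0 :=
  MeasureTheory.measure_iUnion_null fun i => volume_edgeSet Q i

/-- A nonempty open intersection would have positive area, yet it lies on the two boundary curves,
which have area zero. This passes from `inside` to topological interiors without the Jordan curve
theorem. -/
theorem disjoint_interior_closedRegion {m n : ℕ} {Q : Polygon Plane m} {R : Polygon Plane n}
    (h : Disjoint (inside Q) (inside R)) :
    Disjoint (interior (closedRegion Q)) (interior (closedRegion R)) := by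
  rw [disjoint_iff_inter_eq_empty]
  by_contra hne
  have hpos := (isOpen_interior.inter isOpen_interior).measure_pos
    MeasureTheory.volume (nonempty_iff_ne_empty.2 hne)
  refine hpos.ne' (MeasureTheory.measure_mono_null (t := Q.boundary ℝ ∪ R.boundary ℝ) ?_
    (MeasureTheory.measure_union_null (volume_boundary Q) (volume_boundary R)))
  rintro x ⟨hxQ, hxR⟩
  rcases interior_subset hxQ with h1 | h1
  · exact Or.inl h1
  · rcases interior_subset hxR with h2 | h2
    · exact Or.inr h2
    · exact (disjoint_left.1 h h1 h2).elim

theorem IsSimple.rotate_ne {n : ℕ} {Q : Polygon Plane n} (hQ : IsSimple Q) (i : Fin n) :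
    finRotate n i ≠ i := by
  have h3 := hQ.three_le
  obtain ⟨m, rfl⟩ : ∃ m, n = m + 3 := ⟨n - 3, by omega⟩
  rw [finRotate_apply]
  intro h
  simpa using add_eq_left.1 h

/-- The vertices of a simple closed polygonal curve do not lie on a line. -/
theorem IsSimple.not_collinear {n : ℕ} {Q : Polygon Plane n} (hQ : IsSimple Q) :
    ¬ Collinear ℝ (range Q.vertices) := by
  intro hc
  have h3 := hQ.three_le
  have : Nonempty (Fin n) := ⟨⟨0, by omega⟩⟩
  obtain ⟨p, d, hpd⟩ := (collinear_iff_exists_forall_eq_smul_vadd _).1 hc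
  choose c hcv using fun i => hpd (Q.vertices i) (mem_range_self i)
  -- At a vertex extreme along the line, both neighbours lie on the same side, so the two edges
  -- there overlap in more than that vertex.
  obtain ⟨j, -, hj⟩ := Finset.exists_max_image Finset.univ c Finset.univ_nonempty
  set i := (finRotate n).symm j with hi
  have hij : finRotate n i = j := Equiv.apply_symm_apply _ _
  set l := finRotate n j with hl
  have hvi : Q.vertices i ≠ Q.vertices j := fun h => hQ.rotate_ne i (hij.trans (hQ.injective h).symm)
  have hvl : Q.vertices l ≠ Q.vertices j := fun h => hQ.rotate_ne j (hQ.injective h)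
  have hcons := hQ.consecutive i
  rw [hij] at hcons
  have hei : Q.edgeSet ℝ i = segment ℝ (Q.vertices i) (Q.vertices j) := by
    rw [Polygon.edgeSet, hij, affineSegment_eq_segment]
  have hej : Q.edgeSet ℝ j = segment ℝ (Q.vertices j) (Q.vertices l) := by
    rw [Polygon.edgeSet, affineSegment_eq_segment]
  rw [hei, hej] at hcons
  have key : ∀ a b : Fin n, c a ≤ c b → Q.vertices b ∈ segment ℝ (Q.vertices a) (Q.vertices j) := by
    intro a b hab
    rw [hcv a, hcv b, hcv j]
    have hbj := hj b (Finset.mem_univ _)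
    have hmem : c b ∈ segment ℝ (c a) (c j) := by
      rw [segment_eq_Icc (hab.trans hbj)]; exact ⟨hab, hbj⟩
    obtain ⟨s, t, hs, ht, hst, h⟩ := hmem
    refine ⟨s, t, hs, ht, hst, ?_⟩
    simp only [vadd_eq_add, smul_add, smul_smul, ← h, smul_eq_mul]
    rw [add_add_add_comm, ← add_smul, ← add_smul, hst, one_smul]
  rcases le_total (c i) (c l) with h | h
  · have : Q.vertices l ∈ ({Q.vertices j} : Set Plane) := by
      rw [← hcons]; exact ⟨key _ _ h, right_mem_segment ℝ _ _⟩
    exact hvl this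
  · have : Q.vertices i ∈ ({Q.vertices j} : Set Plane) := by
      rw [← hcons]; exact ⟨left_mem_segment ℝ _ _, segment_symm ℝ (Q.vertices l) _ ▸ key _ _ h⟩
    exact hvi this

theorem vertex_mem_edgeSet {n : ℕ} (Q : Polygon Plane n) (i : Fin n) :
    Q.vertices i ∈ Q.edgeSet ℝ i :=
  left_mem_affineSegment ℝ _ _

theorem vertex_mem_boundary {n : ℕ} (Q : Polygon Plane n) (i : Fin n) :
    Q.vertices i ∈ Q.boundary ℝ :=
  mem_iUnion.2 ⟨i, vertex_mem_edgeSet Q i⟩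

theorem IsSimple.interior_nonempty {n : ℕ} {Q : Polygon Plane n} (hQ : IsSimple Q)
    (hc : Convex ℝ (closedRegion Q)) : (interior (closedRegion Q)).Nonempty := by
  rw [hc.interior_nonempty_iff_affineSpan_eq_top]
  by_contra hne
  refine hQ.not_collinear ?_
  have hsub : range Q.vertices ⊆ closedRegion Q := by
    rintro _ ⟨i, rfl⟩
    exact Or.inl (vertex_mem_boundary Q i)
  refine Collinear.subset hsub ?_
  rw [collinear_iff_finrank_le_one, ← direction_affineSpan]
  have hlt : (affineSpan ℝ (closedRegion Q)).direction < ⊤ := by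
    refine lt_top_iff_ne_top.2 fun h => hne ?_
    have hn : ((affineSpan ℝ (closedRegion Q)) : Set Plane).Nonempty := by
      have h3 := hQ.three_le
      exact ⟨_, subset_affineSpan ℝ _ (hsub (mem_range_self ⟨0, by omega⟩))⟩
    exact (AffineSubspace.direction_eq_top_iff_of_nonempty hn).1 h
  have := Submodule.finrank_lt hlt.ne
  rw [finrank_euclideanSpace_fin] at this
  omega

theorem IsSimple.edge_subset_pair {n : ℕ} {Q : Polygon Plane n} (hQ : IsSimple Q) (i j : Fin n)
    (h : Q.vertices i ∈ Q.edgeSet ℝ j) : j = i ∨ j = (finRotate n).symm i := by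
  by_contra! hne
  obtain ⟨h1, h2⟩ := hne
  have h2' : i ≠ finRotate n j := fun h => h2 (by rw [h, Equiv.symm_apply_apply])
  by_cases h3 : j = finRotate n i
  · have : Q.vertices i ∈ ({Q.vertices (finRotate n i)} : Set Plane) := by
      rw [← hQ.consecutive i]
      exact ⟨vertex_mem_edgeSet Q i, h3 ▸ h⟩
    exact hQ.rotate_ne i (hQ.injective this).symm
  · exact disjoint_left.1 (hQ.nonconsecutive i j h1 h3 h2') (vertex_mem_edgeSet Q i) h

/-- Two edges of a simple curve that share a point which is not a vertex are equal. -/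
theorem IsSimple.edge_eq_of_mem {n : ℕ} {Q : Polygon Plane n} (hQ : IsSimple Q) {i j : Fin n}
    {x : Plane} (hi : x ∈ Q.edgeSet ℝ i) (hj : x ∈ Q.edgeSet ℝ j) (hx : x ∉ range Q.vertices) :
    i = j := by
  by_contra hne
  by_cases h1 : j = finRotate n i
  · subst h1
    have : x ∈ ({Q.vertices (finRotate n i)} : Set Plane) := hQ.consecutive i ▸ ⟨hi, hj⟩
    exact hx ⟨_, this.symm⟩
  by_cases h2 : i = finRotate n j
  · subst h2
    have : x ∈ ({Q.vertices (finRotate n j)} : Set Plane) := hQ.consecutive j ▸ ⟨hj, hi⟩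
    exact hx ⟨_, this.symm⟩
  exact disjoint_left.1 (hQ.nonconsecutive i j (Ne.symm hne) h1 h2) hi hj

end KVis

/-! ### Edges and topology of the region of a holed polygon -/

namespace KVis
namespace HoledPolygon

variable (P : HoledPolygon)

theorem sUnion_edges : ⋃₀ P.edges = P.outer.boundary ℝ ∪ ⋃ j, (P.hole j).boundary ℝ := by
  simp only [edges, sUnion_union, sUnion_iUnion, KVis.sUnion_edges]

theorem finite_edges : P.edges.Finite :=
  (finite_range _).union (finite_iUnion fun _ => finite_range _)

theorem isClosed_sUnion_edges : IsClosed (⋃₀ P.edges) := by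
  rw [sUnion_edges]
  exact (isClosed_boundary _).union (isClosed_iUnion_of_finite fun _ => isClosed_boundary _)

theorem isClosed_region : IsClosed P.region :=
  (isClosed_closedRegion _).sdiff (isOpen_iUnion fun j => isOpen_inside _)

/-- The right-hand side is visibly open, so off the edges the polygon and its exterior are two
disjoint open sets; a connected set meeting both must meet an edge. -/
theorem region_diff_edges :
    P.region \ ⋃₀ P.edges = inside P.outer \ ⋃ j, closedRegion (P.hole j) := by
  rw [sUnion_edges]
  ext x
  have h : x ∈ inside P.outer → x ∉ P.outer.boundary ℝ := fun h => h.1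
  simp only [region, closedRegion, mem_sdiff, mem_union, mem_iUnion]
  push Not
  constructor
  · rintro ⟨⟨h1 | h1, h2⟩, h3, h4⟩
    · exact (h3 h1).elim
    · exact ⟨h1, fun j => ⟨h4 j, h2 j⟩⟩
  · rintro ⟨h1, h2⟩
    exact ⟨⟨Or.inr h1, fun j => (h2 j).2⟩, h h1, fun j => (h2 j).1⟩

theorem isOpen_region_diff_edges : IsOpen (P.region \ ⋃₀ P.edges) := by
  rw [region_diff_edges]
  exact (isOpen_inside _).sdiff (isClosed_iUnion_of_finite fun j => isClosed_closedRegion _)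

/-- A path from the polygon to its exterior meets an edge. -/
theorem exists_mem_edge {s : Set Plane} (hs : IsPreconnected s) {x y : Plane} (hx : x ∈ s)
    (hy : y ∈ s) (hxP : x ∈ P.region) (hyP : y ∉ P.region) : ∃ z ∈ s, ∃ e ∈ P.edges, z ∈ e := by
  by_contra! h
  have hE : ∀ z ∈ s, z ∉ ⋃₀ P.edges := fun z hz ⟨e, he, hze⟩ => h z hz e he hze
  obtain ⟨z, -, h1, h2⟩ := hs _ _ P.isOpen_region_diff_edges P.isClosed_region.isOpen_compl
    (fun z hz => by
      by_cases hzP : z ∈ P.region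
      · exact Or.inl ⟨hzP, hE z hz⟩
      · exact Or.inr hzP) ⟨x, hx, hxP, hE x hx⟩ ⟨y, hy, hyP⟩
  exact h2 h1.1

theorem exists_mem_edge_uIcc {f : ℝ → Plane} (hf : Continuous f) {s t : ℝ}
    (hs : f s ∈ P.region) (ht : f t ∉ P.region) :
    ∃ u ∈ uIcc s t, ∃ e ∈ P.edges, f u ∈ e := by
  obtain ⟨_, ⟨u, hu, rfl⟩, h⟩ := P.exists_mem_edge
    (isPreconnected_uIcc.image f hf.continuousOn) (mem_image_of_mem f left_mem_uIcc)
    (mem_image_of_mem f right_mem_uIcc) hs ht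
  exact ⟨u, hu, h⟩

theorem range_hole_vertices_subset (j : Fin P.holeCount) :
    range (P.hole j).vertices ⊆ P.vertices :=
  (subset_iUnion (fun j => range (P.hole j).vertices) j).trans subset_union_right

theorem segment_of_mem_edges {e : Set Plane} (he : e ∈ P.edges) :
    ∃ a b, a ≠ b ∧ a ∈ P.vertices ∧ b ∈ P.vertices ∧ e = segment ℝ a b := by
  have key : ∀ {n : ℕ} {Q : Polygon Plane n}, IsSimple Q → range Q.vertices ⊆ P.vertices →
      e ∈ KVis.edges Q → ∃ a b, a ≠ b ∧ a ∈ P.vertices ∧ b ∈ P.vertices ∧ e = segment ℝ a b := by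
    rintro n Q hQ hsub ⟨i, rfl⟩
    exact ⟨_, _, fun h => hQ.rotate_ne i (hQ.injective h).symm, hsub (mem_range_self _),
      hsub (mem_range_self _), affineSegment_eq_segment ℝ _ _⟩
  rcases he with he | he
  · exact key P.outer_simple subset_union_left he
  · obtain ⟨j, he⟩ := mem_iUnion.1 he
    exact key (P.hole_simple j) (P.range_hole_vertices_subset j) he

theorem finite_vertices : P.vertices.Finite :=
  (finite_range _).union (finite_iUnion fun _ => finite_range _)

theorem disjoint_boundary_outer_hole (j : Fin P.holeCount) :
    Disjoint (P.outer.boundary ℝ) ((P.hole j).boundary ℝ) :=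
  disjoint_left.2 fun _ h1 h2 => (P.hole_subset j (Or.inl h2)).1 h1

theorem disjoint_boundary_hole {i j : Fin P.holeCount} (h : i ≠ j) :
    Disjoint ((P.hole i).boundary ℝ) ((P.hole j).boundary ℝ) :=
  (P.holes_disjoint i j h).mono subset_union_left subset_union_left

theorem mem_boundary_of_mem_edge {n : ℕ} {Q : Polygon Plane n} {e : Set Plane} {x : Plane}
    (he : e ∈ KVis.edges Q) (hx : x ∈ e) : x ∈ Q.boundary ℝ :=
  KVis.sUnion_edges Q ▸ mem_sUnion_of_mem hx he

theorem edges_of_mem_outer {x : Plane} (hx : x ∈ P.outer.boundary ℝ) {e : Set Plane}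
    (he : e ∈ P.edges) (hxe : x ∈ e) : e ∈ KVis.edges P.outer := by
  rcases he with he | he
  · exact he
  · obtain ⟨j, he⟩ := mem_iUnion.1 he
    exact (disjoint_left.1 (P.disjoint_boundary_outer_hole j) hx
      (mem_boundary_of_mem_edge he hxe)).elim

theorem edges_of_mem_hole {x : Plane} {j : Fin P.holeCount} (hx : x ∈ (P.hole j).boundary ℝ)
    {e : Set Plane} (he : e ∈ P.edges) (hxe : x ∈ e) : e ∈ KVis.edges (P.hole j) := by
  rcases he with he | he
  · exact (disjoint_left.1 (P.disjoint_boundary_outer_hole j)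
      (mem_boundary_of_mem_edge he hxe) hx).elim
  · obtain ⟨i, he⟩ := mem_iUnion.1 he
    by_cases h : i = j
    · exact h ▸ he
    · exact (disjoint_left.1 (P.disjoint_boundary_hole h)
        (mem_boundary_of_mem_edge he hxe) hx).elim

/-- At most two edges meet at a vertex. -/
theorem encard_edges_at_vertex {v : Plane} (hv : v ∈ P.vertices) :
    {e ∈ P.edges | v ∈ e}.encard ≤ 2 := by
  have key : ∀ {n : ℕ} {Q : Polygon Plane n}, IsSimple Q → v ∈ range Q.vertices →
      (∀ e ∈ P.edges, v ∈ e → e ∈ KVis.edges Q) → {e ∈ P.edges | v ∈ e}.encard ≤ 2 := by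
    rintro n Q hQ ⟨i, rfl⟩ h
    refine (encard_le_encard (t := {Q.edgeSet ℝ i, Q.edgeSet ℝ ((finRotate n).symm i)}) ?_).trans
      ((encard_insert_le _ _).trans (by rw [encard_singleton]; rfl))
    rintro e ⟨he, hve⟩
    obtain ⟨j, rfl⟩ := h e he hve
    rcases hQ.edge_subset_pair i j hve with rfl | rfl
    · exact Or.inl rfl
    · exact Or.inr rfl
  rcases hv with hv | hv
  · obtain ⟨i, rfl⟩ := hv
    exact key P.outer_simple ⟨i, rfl⟩ fun e => P.edges_of_mem_outer (vertex_mem_boundary _ i)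
  · obtain ⟨j, i, rfl⟩ := mem_iUnion.1 hv
    exact key (P.hole_simple j) ⟨i, rfl⟩ fun e => P.edges_of_mem_hole (vertex_mem_boundary _ i)

/-- A point of two edges is a vertex. -/
theorem edge_eq_of_mem {e f : Set Plane} (he : e ∈ P.edges) (hf : f ∈ P.edges) {x : Plane}
    (hxe : x ∈ e) (hxf : x ∈ f) (hx : x ∉ P.vertices) : e = f := by
  have key : ∀ {n : ℕ} {Q : Polygon Plane n}, IsSimple Q → range Q.vertices ⊆ P.vertices →
      e ∈ KVis.edges Q → f ∈ KVis.edges Q → e = f := by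
    rintro n Q hQ hsub ⟨i, rfl⟩ ⟨j, rfl⟩
    rw [hQ.edge_eq_of_mem hxe hxf fun h => hx (hsub h)]
  rcases he with he' | he'
  · exact key P.outer_simple subset_union_left he'
      (P.edges_of_mem_outer (mem_boundary_of_mem_edge he' hxe) hf hxf)
  · obtain ⟨j, he'⟩ := mem_iUnion.1 he'
    exact key (P.hole_simple j) (P.range_hole_vertices_subset j) he' (P.edges_of_mem_hole (mem_boundary_of_mem_edge he' hxe) hf hxf)

/-- If all edges lie in a closed convex subset of the polygon, the polygon is convex. -/
theorem region_eq_of_edges_subset {K : Set Plane} (hK : Convex ℝ K) (hKc : IsClosed K)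
    (hKP : K ⊆ P.region) (hE : ∀ e ∈ P.edges, e ⊆ K) : P.region = K := by
  refine Subset.antisymm (fun x hx => ?_) hKP
  by_contra hxK
  obtain ⟨f, u, hfx, hfK⟩ := geometric_hahn_banach_point_closed hK hKc hxK
  have h0 : 0 < P.outerSize := by have := P.outer_simple.three_le; omega
  have hne : P.outer.vertices ⟨0, h0⟩ ∈ K :=
    hE (P.outer.edgeSet ℝ ⟨0, h0⟩) (Or.inl (mem_range_self _)) (vertex_mem_edgeSet _ _)
  set d : Plane := x - P.outer.vertices ⟨0, h0⟩ with hd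
  have hfd : f d < 0 := by rw [hd, map_sub]; linarith [hfK _ hne]
  -- The functional decreases along this ray, so it never meets `K` or the outer curve. Being
  -- unbounded, it cannot stay in a bounded component.
  set ray : Set Plane := (fun t : ℝ => x + t • d) '' Ici 0 with hray
  have hrayK : Disjoint ray K := by
    refine disjoint_left.2 ?_
    rintro _ ⟨t, ht, rfl⟩ h
    have := hfK _ h
    simp only [map_add, map_smul, smul_eq_mul] at this
    nlinarith [mem_Ici.1 ht]
  have hpre : IsPreconnected ray :=
    isPreconnected_Ici.image _ (by fun_prop)
  have hbd : P.outer.boundary ℝ ⊆ K := by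
    rw [← KVis.sUnion_edges]
    exact sUnion_subset fun e he => hE e (Or.inl he)
  have hxray : x ∈ ray := ⟨0, self_mem_Ici, by simp⟩
  rcases hx.1 with hx1 | hx1
  · exact hxK (hbd hx1)
  have hsub := hpre.subset_connectedComponentIn hxray
    (hrayK.mono_right hbd).subset_compl_right
  obtain ⟨R, hR⟩ := (hx1.2.subset hsub).exists_norm_le
  have hdpos : 0 < ‖d‖ := norm_pos_iff.2 fun h => by simp [h] at hfd
  have hRx : 0 ≤ R := (norm_nonneg x).trans (hR x hxray)
  have h1 := hR _ ⟨(R + ‖x‖ + 1) / ‖d‖, mem_Ici.2 (by positivity), rfl⟩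
  have h2 : ‖((R + ‖x‖ + 1) / ‖d‖) • d‖ = R + ‖x‖ + 1 := by
    rw [norm_smul, Real.norm_of_nonneg (by positivity), div_mul_cancel₀ _ hdpos.ne']
  have h3 := norm_sub_le (x + ((R + ‖x‖ + 1) / ‖d‖) • d) x
  rw [add_sub_cancel_left, h2] at h3
  simp only at h1
  linarith

end HoledPolygon
end KVis

/-! ### Exits from the polygon and criteria for visibility -/

namespace KVis
namespace HoledPolygon

variable (P : HoledPolygon)

theorem exists_edge_at_first_exit {f : ℝ → Plane} (hf : Continuous f) (h0 : f 0 ∈ P.region)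
    {t₁ : ℝ} (ht₁ : t₁ ∈ Icc (0 : ℝ) 1) (h1 : f t₁ ∉ P.region) :
    ∃ e ∈ P.edges, ∃ u, f u ∈ e ∧ 0 ≤ u ∧ IsGLB {t ∈ Icc (0 : ℝ) 1 | f t ∉ P.region} u := by
  set T : Set ℝ := {t ∈ Icc (0 : ℝ) 1 | f t ∉ P.region} with hT
  have hne : T.Nonempty := ⟨t₁, ht₁, h1⟩
  have hbdd : BddBelow T := ⟨0, fun t ht => ht.1.1⟩
  have hnn : 0 ≤ sInf T := le_csInf hne fun t ht => ht.1.1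
  suffices h : f (sInf T) ∈ ⋃₀ P.edges by
    obtain ⟨e, he, hfe⟩ := h
    exact ⟨e, he, sInf T, hfe, hnn, isGLB_csInf hne hbdd⟩
  by_contra hE
  obtain ⟨δ, hδ, hball⟩ := Metric.isOpen_iff.1
    (P.isClosed_sUnion_edges.isOpen_compl.preimage hf) (sInf T) hE
  obtain ⟨t, ht, htδ⟩ := exists_lt_of_csInf_lt hne (lt_add_of_pos_right (sInf T) hδ)
  have htge : sInf T ≤ t := csInf_le hbdd ht
  -- A time just before the infimum, truncated at the start: the polygon may be left immediately,
  -- and then `h0` supplies the point inside.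
  set s := max 0 (sInf T - δ / 2) with hs
  have hs1 : sInf T - δ / 2 ≤ s := le_max_right _ _
  have hs2 : s ≤ sInf T := max_le hnn (by linarith)
  have hs0 : 0 ≤ s := le_max_left _ _
  have hsP : f s ∈ P.region := by
    by_contra hsP
    have hsT : sInf T ≤ s := csInf_le hbdd ⟨⟨hs0, (hs2.trans htge).trans ht.1.2⟩, hsP⟩
    rcases max_choice 0 (sInf T - δ / 2) with h | h
    · rw [← hs] at h
      rw [h] at hsP
      exact hsP h0
    · rw [← hs] at h
      linarith
  obtain ⟨u, hu, e, he, hue⟩ := P.exists_mem_edge_uIcc hf hsP ht.2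
  rw [uIcc_of_le (hs2.trans htge)] at hu
  refine hball (a := u) ?_ ⟨e, he, hue⟩
  rw [Metric.mem_ball, Real.dist_eq, abs_lt]
  constructor <;> linarith [hu.1, hu.2]

variable {P}

theorem kVisible_of_segment_subset {k : ℕ} {x y : Plane} (h : segment ℝ x y ⊆ P.region) :
    P.KVisible k x y := by
  refine ⟨∅, empty_subset _, by simp, fun s _ t ht _ h' => (h' (h ?_)).elim⟩
  rw [segment_eq_image_lineMap]
  exact mem_image_of_mem _ ht

theorem kVisible_of_mem_ball {k : ℕ} (hk : 2 ≤ k) {v : Plane} (hv : v ∈ P.vertices) {ρ : ℝ}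
    (hρ : ∀ e ∈ P.edges, (Metric.ball v ρ ∩ e).Nonempty → v ∈ e) {x y : Plane}
    (hx : x ∈ Metric.ball v ρ) (hy : y ∈ Metric.ball v ρ) (hxP : x ∈ P.region)
    (hyP : y ∈ P.region) : P.KVisible k x y := by
  refine ⟨{e ∈ P.edges | v ∈ e}, sep_subset _ _,
    (P.encard_edges_at_vertex hv).trans (by exact_mod_cast hk), fun s hs t ht h ht' => ?_⟩
  have hs' : AffineMap.lineMap x y s ∈ P.region := by
    rcases h with rfl | rfl | h
    · simpa using hxP
    · simpa using hyP
    · exact interior_subset h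
  obtain ⟨u, hu, e, he, hue⟩ := P.exists_mem_edge_uIcc AffineMap.lineMap_continuous hs' ht'
  have hu1 : u ∈ Icc (0 : ℝ) 1 := uIcc_subset_Icc hs ht hu
  have hmem : AffineMap.lineMap x y u ∈ Metric.ball v ρ :=
    (convex_ball v ρ).segment_subset hx hy
      (by rw [segment_eq_image_lineMap]; exact mem_image_of_mem _ hu1)
  exact ⟨u, hu, e, ⟨he, hρ e he ⟨_, hmem, hue⟩⟩, hue⟩

/-- Without an out-in-out pattern, the edges at the first exits from `y` and from `x` form a valid
set of at most two: an interior point strictly between these exits would have exterior points on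
both sides. -/
theorem exists_of_not_kVisible {k : ℕ} (hk : 2 ≤ k) {x y : Plane} (hxP : x ∈ P.region)
    (hyP : y ∈ P.region) (h : ¬ P.KVisible k y x) :
    ∃ t₁ s t₂ : ℝ, 0 ≤ t₁ ∧ t₁ < s ∧ s < t₂ ∧ t₂ ≤ 1 ∧
      AffineMap.lineMap x y t₁ ∉ P.region ∧
      (AffineMap.lineMap x y s : Plane) ∈ interior P.region ∧
      AffineMap.lineMap x y t₂ ∉ P.region := by
  have hrev : ∀ t : ℝ, (AffineMap.lineMap y x t : Plane) = AffineMap.lineMap x y (1 - t) :=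
    fun t => (AffineMap.lineMap_apply_one_sub x y t).symm
  by_contra! hcon
  refine h ?_
  by_cases hT : ∃ t ∈ Icc (0 : ℝ) 1, (AffineMap.lineMap y x t : Plane) ∉ P.region
  swap
  · push Not at hT
    refine kVisible_of_segment_subset ?_
    rw [segment_eq_image_lineMap]
    rintro _ ⟨t, ht, rfl⟩
    exact hT t ht
  obtain ⟨t₀, ht₀, htP₀⟩ := hT
  obtain ⟨e, he, u, hue, hu0, hu⟩ := P.exists_edge_at_first_exit
    (f := fun t => AffineMap.lineMap y x t) AffineMap.lineMap_continuous
    (by simpa using hyP) ht₀ htP₀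
  obtain ⟨e', he', u', hue', hu0', hu'⟩ := P.exists_edge_at_first_exit
    (f := fun t => AffineMap.lineMap x y t) AffineMap.lineMap_continuous
    (by simpa using hxP) (t₁ := 1 - t₀) ⟨by linarith [ht₀.2], by linarith [ht₀.1]⟩
    (by rwa [hrev] at htP₀)
  refine ⟨{e, e'}, ?_, ?_, ?_⟩
  · rintro f (rfl | rfl) <;> assumption
  · refine (encard_insert_le _ _).trans ?_
    rw [encard_singleton]
    exact_mod_cast hk
  intro s hs t ht hsP htP
  have hut : u ≤ t := hu.1 ⟨ht, htP⟩
  have hut' : u' ≤ 1 - t :=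
    hu'.1 ⟨⟨by linarith [ht.2], by linarith [ht.1]⟩, by rwa [hrev] at htP⟩
  have case1 : s ≤ u → ∃ u ∈ uIcc s t, ∃ f ∈ ({e, e'} : Set (Set Plane)),
      (AffineMap.lineMap y x u : Plane) ∈ f := fun h =>
    ⟨u, mem_uIcc.2 (Or.inl ⟨h, hut⟩), e, Or.inl rfl, hue⟩
  have case2 : 1 - u' ≤ s → ∃ u ∈ uIcc s t, ∃ f ∈ ({e, e'} : Set (Set Plane)),
      (AffineMap.lineMap y x u : Plane) ∈ f := fun h =>
    ⟨1 - u', mem_uIcc.2 (Or.inr ⟨by linarith, h⟩), e', Or.inr rfl, by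
      rw [hrev, sub_sub_cancel]; exact hue'⟩
  rcases hsP with rfl | rfl | hsP
  · exact case1 hu0
  · exact case2 (by linarith)
  by_contra hcc
  have hsu : u < s := lt_of_not_ge fun h => hcc (case1 h)
  have hsu' : s < 1 - u' := lt_of_not_ge fun h => hcc (case2 h)
  obtain ⟨a, ⟨ha, haP⟩, -, has⟩ := hu.exists_between hsu
  obtain ⟨b, ⟨hb, hbP⟩, -, hbs⟩ := hu'.exists_between (show u' < 1 - s by linarith)
  simp only [hrev] at haP
  rw [hrev] at hsP
  exact haP (hcon b (1 - s) (1 - a) hb.1 hbs (by linarith) (by linarith [ha.1]) hbP hsP)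

end HoledPolygon
end KVis

/-! ### The order of disjoint convex sets seen from a point -/

namespace KVis

/-- Seen from `x`, some point of `s` lies strictly before a point of `t`. -/
def InFront {E : Type*} [AddCommGroup E] [Module ℝ E] (x : E) (s t : Set E) : Prop :=
  ∃ p ∈ s, ∃ c : ℝ, 1 < c ∧ x + c • (p - x) ∈ t

section Order

variable {E : Type*} [NormedAddCommGroup E] [NormedSpace ℝ E] {x : E} {s t : Set E}

/-- Of two disjoint open convex sets, one is in front of the other along all common rays. -/
theorem InFront.one_lt (h : InFront x s t) (hs : Convex ℝ s) (hso : IsOpen s) (ht : Convex ℝ t)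
    (hto : IsOpen t) (hst : Disjoint s t) {q : E} (hq : q ∈ s) {c : ℝ} (hc : 0 < c)
    (hcq : x + c • (q - x) ∈ t) : 1 < c := by
  obtain ⟨p, hp, l, hl, hpl⟩ := h
  obtain ⟨f, u, hfs, hft⟩ := geometric_hahn_banach_open_open hs hso ht hto hst
  have h1 := hfs _ hp
  have h2 := hft _ hpl
  have h3 := hfs _ hq
  have h4 := hft _ hcq
  simp only [map_add, map_smul, map_sub, smul_eq_mul] at h2 h4
  by_contra! hc1
  have hx : f x < u := by
    by_contra! hx
    nlinarith
  nlinarith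

theorem InFront.asymm (h : InFront x s t) (hs : Convex ℝ s) (hso : IsOpen s) (ht : Convex ℝ t)
    (hto : IsOpen t) (hst : Disjoint s t) : ¬ InFront x t s := by
  rintro ⟨q, hq, c, hc, hcq⟩
  have h1 : x + c⁻¹ • (x + c • (q - x) - x) ∈ t := by
    rwa [add_sub_cancel_left, smul_smul, inv_mul_cancel₀ (by positivity), one_smul,
      add_sub_cancel]
  have := h.one_lt hs hso ht hto hst hcq (inv_pos.2 (by linarith)) h1
  exact absurd this (not_lt.2 (inv_le_one_of_one_le₀ hc.le))

end Order

/-- Finitely many disjoint open convex sets in an open half plane bounded by a line through `x`: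
one of them has none of the others in front of it, as seen from `x`. -/
theorem exists_forall_not_inFront {E ι : Type*} [NormedAddCommGroup E] [NormedSpace ℝ E] {x : E}
    (h m : E →L[ℝ] ℝ) (hinj : ∀ d, h d = 0 → m d = 0 → d = 0) {w : E} (hw : h w = 0)
    (hmw : m w = 1) (O : ι → Set E) (F : Finset ι) (hF : F.Nonempty)
    (hopen : ∀ i ∈ F, IsOpen (O i)) (hconv : ∀ i ∈ F, Convex ℝ (O i))
    (hne : ∀ i ∈ F, (O i).Nonempty) (hpos : ∀ i ∈ F, ∀ p ∈ O i, 0 < h (p - x))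
    (hdisj : ∀ i ∈ F, ∀ j ∈ F, i ≠ j → Disjoint (O i) (O j)) :
    ∃ i ∈ F, ∀ j ∈ F, j ≠ i → ¬ InFront x (O j) (O i) := by
  classical
  set a : E → ℝ := fun p => m (p - x) / h (p - x) with ha
  -- The supremum of the directions in which `O i` is seen; `arctan` only makes it bounded.
  set r : ι → ℝ := fun i => sSup ((fun p => Real.arctan (a p)) '' O i) with hr
  have hbdd : ∀ i, BddAbove ((fun p => Real.arctan (a p)) '' O i) := fun i =>
    ⟨Real.pi / 2, by rintro _ ⟨p, -, rfl⟩; exact (Real.arctan_lt_pi_div_two _).le⟩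
  have hlt : ∀ i ∈ F, ∀ p ∈ O i, Real.arctan (a p) < r i := by
    -- The supremum is not attained, because moving `p` along `w` keeps `h` and increases `m`.
    intro i hi p hp
    have hnhds : ∀ᶠ e in nhdsWithin (0 : ℝ) (Ioi 0), p + e • w ∈ O i := by
      have hcont : ContinuousAt (fun e : ℝ => p + e • w) 0 := by fun_prop
      exact (hcont.eventually_mem (by simpa using (hopen i hi).mem_nhds hp)).filter_mono
        nhdsWithin_le_nhds
    obtain ⟨e, he, he0⟩ := (hnhds.and self_mem_nhdsWithin).exists
    refine lt_of_lt_of_le ?_ (le_csSup (hbdd i) ⟨_, he, rfl⟩)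
    refine Real.arctan_strictMono ?_
    have hp0 := hpos i hi p hp
    have h1 : p + e • w - x = (p - x) + e • w := by abel
    simp only [ha, h1, map_add, map_smul, hw, hmw, smul_eq_mul, mul_one, mul_zero, add_zero]
    exact div_lt_div_of_pos_right (lt_add_of_pos_right _ he0) hp0
  have hex : ∀ i ∈ F, ∀ M < r i, ∃ p ∈ O i, M < Real.arctan (a p) := by
    intro i hi M hM
    obtain ⟨_, ⟨p, hp, rfl⟩, h⟩ := exists_lt_of_lt_csSup ((hne i hi).image _) hM
    exact ⟨p, hp, h⟩
  have hord : ∀ i ∈ F, OrdConnected ((fun p => Real.arctan (a p)) '' O i) := by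
    intro i hi
    refine ((hconv i hi).isPreconnected.image _ ?_).ordConnected
    refine Real.continuous_arctan.comp_continuousOn (ContinuousOn.div (by fun_prop) (by fun_prop) ?_)
    exact fun p hp => (hpos i hi p hp).ne'
  have hray : ∀ i ∈ F, ∀ j ∈ F, ∀ p ∈ O i, ∀ q ∈ O j, Real.arctan (a p) = Real.arctan (a q) →
      ∃ c : ℝ, 0 < c ∧ q = x + c • (p - x) := by
    intro i hi j hj p hp q hq hpq
    have hp0 := hpos i hi p hp
    have hq0 := hpos j hj q hq
    have hpq' : m (p - x) / h (p - x) = m (q - x) / h (q - x) := Real.arctan_injective hpq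
    rw [div_eq_div_iff hp0.ne' hq0.ne'] at hpq'
    refine ⟨h (q - x) / h (p - x), div_pos hq0 hp0, ?_⟩
    rw [← sub_eq_iff_eq_add', ← sub_eq_zero]
    refine hinj _ ?_ ?_
    · rw [map_sub h, map_smul, smul_eq_mul, div_mul_cancel₀ _ hp0.ne', sub_self]
    · rw [map_sub m, map_smul, smul_eq_mul]
      field_simp
      linarith
  have hangle : ∀ (p : E) (c : ℝ), 0 < c → a (x + c • (p - x)) = a p := by
    intro p c hc
    simp only [ha, add_sub_cancel_left, map_smul, smul_eq_mul]
    exact mul_div_mul_left _ _ hc.ne'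
  induction F using Finset.strongInduction with
  | H F ih =>
  -- `K` has the smallest supremum, and `L` is frontmost among the others. If `K` is not in front of
  -- `L`, then `L` wins; otherwise `K` does. Indeed, if `N` is in front of `K`, a direction just
  -- below `r K` meets `N`, `K` and `L`, and on that ray `N` precedes `L`, contradicting the choice
  -- of `L`.
  obtain ⟨K, hK, hKmin⟩ := F.exists_min_image r hF
  by_cases hF' : (F.erase K).Nonempty
  swap
  · refine ⟨K, hK, fun j hj hjK => (hF' ⟨j, Finset.mem_erase.2 ⟨hjK, hj⟩⟩).elim⟩
  have hsub : ∀ i ∈ F.erase K, i ∈ F := fun i => Finset.mem_of_mem_erase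
  obtain ⟨L, hL, hLmin⟩ := ih (F.erase K) (Finset.erase_ssubset hK) hF'
    (fun i hi => hopen i (hsub i hi)) (fun i hi => hconv i (hsub i hi))
    (fun i hi => hne i (hsub i hi)) (fun i hi => hpos i (hsub i hi))
    (fun i hi j hj => hdisj i (hsub i hi) j (hsub j hj))
    (fun i hi => hlt i (hsub i hi)) (fun i hi => hex i (hsub i hi))
    (fun i hi => hord i (hsub i hi)) (fun i hi j hj => hray i (hsub i hi) j (hsub j hj))
  have hLF := hsub L hL
  have hLK : L ≠ K := Finset.ne_of_mem_erase hL
  by_cases hKL : InFront x (O K) (O L)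
  swap
  · refine ⟨L, hLF, fun j hj hjL => ?_⟩
    by_cases hjK : j = K
    · exact hjK ▸ hKL
    · exact hLmin j (Finset.mem_erase.2 ⟨hjK, hj⟩) hjL
  refine ⟨K, hK, fun N hN hNK hNK' => ?_⟩
  have hNL : N ≠ L := by
    rintro rfl
    exact hKL.asymm (hconv K hK) (hopen K hK) (hconv N hN) (hopen N hN)
      (hdisj K hK N hN hNK.symm) hNK'
  refine hLmin N (Finset.mem_erase.2 ⟨hNK, hN⟩) hNL ?_
  obtain ⟨p, hp, c, hc, hpc⟩ := id hNK'
  obtain ⟨q, hq, d, hd, hqd⟩ := id hKL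
  have e1 := hlt K hK _ hpc
  have e2 := hlt K hK _ hq
  set M := max (Real.arctan (a (x + c • (p - x)))) (Real.arctan (a q)) with hM
  have hMK : M < r K := max_lt e1 e2
  obtain ⟨yK, hyK, hyKM⟩ := hex K hK M hMK
  obtain ⟨yN, hyN, hyNM⟩ := hex N hN M (hMK.trans_le (hKmin N hN))
  obtain ⟨yL, hyL, hyLM⟩ := hex L hLF M (hMK.trans_le (hKmin L hLF))
  set y := min (Real.arctan (a yK)) (min (Real.arctan (a yN)) (Real.arctan (a yL))) with hy
  have hMy : M < y := lt_min hyKM (lt_min hyNM hyLM)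
  obtain ⟨k', hk', hk'y⟩ : y ∈ (fun p => Real.arctan (a p)) '' O K :=
    (hord K hK).out ⟨q, hq, rfl⟩ ⟨yK, hyK, rfl⟩
      ⟨(le_max_right _ _).trans hMy.le, min_le_left _ _⟩
  obtain ⟨n', hn', hn'y⟩ : y ∈ (fun p => Real.arctan (a p)) '' O N :=
    (hord N hN).out ⟨p, hp, rfl⟩ ⟨yN, hyN, rfl⟩
      ⟨by
        have := hangle p c (by linarith)
        simp only [← this]
        exact (le_max_left _ _).trans hMy.le, (min_le_right _ _).trans (min_le_left _ _)⟩
  obtain ⟨l', hl', hl'y⟩ : y ∈ (fun p => Real.arctan (a p)) '' O L :=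
    (hord L hLF).out ⟨_, hqd, rfl⟩ ⟨yL, hyL, rfl⟩
      ⟨by
        simp only [hangle q d (by linarith)]
        exact (le_max_right _ _).trans hMy.le, (min_le_right _ _).trans (min_le_right _ _)⟩
  obtain ⟨c₁, hc₁, rfl⟩ := hray N hN K hK n' hn' k' hk' (hn'y.trans hk'y.symm)
  obtain ⟨c₂, hc₂, rfl⟩ := hray K hK L hLF _ hk' l' hl' (hk'y.trans hl'y.symm)
  have f1 := hNK'.one_lt (hconv N hN) (hopen N hN) (hconv K hK) (hopen K hK)
    (hdisj N hN K hK hNK) hn' hc₁ hk'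
  have f2 := hKL.one_lt (hconv K hK) (hopen K hK) (hconv L hLF) (hopen L hLF)
    (hdisj K hK L hLF hLK.symm) hk' hc₂ hl'
  refine ⟨n', hn', c₂ * c₁, by nlinarith, ?_⟩
  rwa [add_sub_cancel_left, smul_smul] at hl'

end KVis

/-! ### Pieces of the decomposition and blocked views -/

namespace KVis
namespace HoledPolygon
namespace ConvexDecomposition

variable {P : HoledPolygon} {C : ℕ} (D : P.ConvexDecomposition C)

/-- A piece of a decomposition, as a closed set of points. -/
def body (i : Fin C) : Set Plane := closedRegion (D.piece i)

/-- The edges of the polygon that are edges of a given piece. -/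
def realEdges (i : Fin C) : Set (Set Plane) := P.edges ∩ KVis.edges (D.piece i)

theorem body_subset_region (i : Fin C) : D.body i ⊆ P.region :=
  D.cover ▸ subset_iUnion (fun i => closedRegion (D.piece i)) i

theorem subset_body {i : Fin C} {e : Set Plane} (he : e ∈ D.realEdges i) : e ⊆ D.body i :=
  edge_subset_closedRegion he.2

theorem exists_mem_realEdges {e : Set Plane} (he : e ∈ P.edges) : ∃ i, e ∈ D.realEdges i := by
  obtain ⟨i, hi, -⟩ := D.edge_unique e he
  exact ⟨i, he, hi⟩

theorem eq_of_mem_realEdges {e : Set Plane} {i j : Fin C} (hi : e ∈ D.realEdges i)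
    (hj : e ∈ D.realEdges j) : i = j :=
  (D.edge_unique e hi.1).unique hi.2 hj.2

theorem body_subset_closure_interior (i : Fin C) : D.body i ⊆ closure (interior (D.body i)) := by
  unfold body
  rw [(D.convex i).closure_interior_eq_closure_of_nonempty_interior
    ((D.simple i).interior_nonempty (D.convex i))]
  exact subset_closure

theorem disjoint_interior_body {i j : Fin C} (h : i ≠ j) :
    Disjoint (interior (D.body i)) (interior (D.body j)) :=
  disjoint_interior_closedRegion (D.nonoverlapping i j h)

theorem exists_realEdges_nonempty_ne (hP : ¬ Convex ℝ P.region) (A : Fin C) :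
    ∃ B, B ≠ A ∧ (D.realEdges B).Nonempty := by
  by_contra! h
  refine hP ?_
  rw [P.region_eq_of_edges_subset (K := D.body A) (D.convex A) (isClosed_closedRegion _)
    (D.body_subset_region A) ?_]
  · exact D.convex A
  · intro e he
    obtain ⟨i, hi⟩ := D.exists_mem_realEdges he
    by_cases hiA : i = A
    · exact hiA ▸ D.subset_body hi
    · exact absurd hi (by rw [h i hiA]; exact notMem_empty e)

/-- If the view from `x` to a point of the piece `B` is blocked, then some other piece that has an
edge on the way lies in front of `B`, and it can be chosen different from a given piece `A`, if no
other piece with real edges contains `x`. -/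
theorem exists_inFront_of_not_kVisible {k : ℕ} (hk : 2 ≤ k) {x : Plane} (hx : x ∈ P.region)
    {A B : Fin C} (hA : ∀ i, (D.realEdges i).Nonempty → x ∈ D.body i → i = A) {g : Plane}
    (hg : g ∈ D.body B) (hgx : ¬ P.KVisible k g x) (h : Plane →L[ℝ] ℝ) (hpos : 0 < h (g - x)) :
    ∃ i, i ≠ A ∧ i ≠ B ∧ (∃ e ∈ D.realEdges i, ∃ y ∈ e, 0 < h (y - x)) ∧
      InFront x (interior (D.body i) ∩ {p | 0 < h (p - x)})
        (interior (D.body B) ∩ {p | 0 < h (p - x)}) := by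
  obtain ⟨t₁, s, t₂, ht₁, hs₁, hs₂, ht₂, hP₁, hPs, hP₂⟩ :=
    exists_of_not_kVisible hk hx (D.body_subset_region B hg) hgx
  have hopen : IsOpen {p : Plane | 0 < h (p - x)} :=
    isOpen_lt continuous_const (h.continuous.comp (continuous_id.sub continuous_const))
  have hcont : ∀ t : ℝ, Continuous fun p : Plane => (AffineMap.lineMap x p t : Plane) := by
    intro t
    simp only [AffineMap.lineMap_apply]
    fun_prop
  -- The out-in-out pattern is an open condition on the endpoint, so the endpoint can be moved into
  -- the interior of `B`.
  obtain ⟨g', ⟨⟨⟨hg₁, hgs⟩, hg₂⟩, hgh⟩, hgB⟩ := mem_closure_iff.1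
    (D.body_subset_closure_interior B hg) _
    ((((P.isClosed_region.isOpen_compl.preimage (hcont t₁)).inter
      (isOpen_interior.preimage (hcont s))).inter
      (P.isClosed_region.isOpen_compl.preimage (hcont t₂))).inter hopen)
    ⟨⟨⟨hP₁, hPs⟩, hP₂⟩, hpos⟩
  set f : ℝ → Plane := fun t => AffineMap.lineMap x g' t with hf
  have hfc : Continuous f := AffineMap.lineMap_continuous
  have hf0 : f 0 = x := AffineMap.lineMap_apply_zero _ _
  have hf1 : f 1 = g' := AffineMap.lineMap_apply_one _ _
  replace hg₁ : f t₁ ∉ P.region := hg₁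
  replace hg₂ : f t₂ ∉ P.region := hg₂
  replace hgs : f s ∈ P.region := interior_subset hgs
  have hbetween : ∀ i a b c, f a ∈ D.body i → f c ∈ D.body i → a ≤ b → b ≤ c →
      f b ∈ P.region := by
    intro i a b c ha hc hab hbc
    refine D.body_subset_region i ((D.convex i).segment_subset ha hc ?_)
    have hb : b ∈ segment ℝ a c := by
      rw [segment_eq_Icc (hab.trans hbc)]
      exact ⟨hab, hbc⟩
    have := mem_image_of_mem (AffineMap.lineMap x g' : ℝ →ᵃ[ℝ] Plane) hb
    rwa [image_segment] at this
  have ht₁0 : 0 < t₁ := ht₁.lt_of_ne fun h => hg₁ (by rwa [← h, hf0])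
  have ht₂1 : t₂ < 1 := ht₂.lt_of_ne fun h => hg₂ (by
    rw [h, hf1]; exact D.body_subset_region B (interior_subset hgB))
  have key : ∀ i u, 0 < u → u < t₂ → (∃ e ∈ D.realEdges i, f u ∈ e) → i ≠ A →
      ∃ i, i ≠ A ∧ i ≠ B ∧ (∃ e ∈ D.realEdges i, ∃ y ∈ e, 0 < h (y - x)) ∧
      InFront x (interior (D.body i) ∩ {p | 0 < h (p - x)})
        (interior (D.body B) ∩ {p | 0 < h (p - x)}) := by
    rintro i u hu0 hu ⟨e, he, hue⟩ hiA
    have hfu : f u = x + u • (g' - x) := by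
      simp only [hf, AffineMap.lineMap_apply, vsub_eq_sub, vadd_eq_add]
      abel
    have hui := D.subset_body he hue
    -- The dilation about `x` that takes `f u` to `g'`; a point of the interior of piece `i` close
    -- to `f u` still lands in the interior of `B`.
    have hφ : Continuous fun z : Plane => x + u⁻¹ • (z - x) := by fun_prop
    obtain ⟨z, ⟨hzB, hzh⟩, hzi⟩ := mem_closure_iff.1 (D.body_subset_closure_interior i hui) _
      ((isOpen_interior (s := D.body B)).inter hopen |>.preimage hφ) (by
        simp only [mem_preimage, hfu, add_sub_cancel_left, smul_smul, inv_mul_cancel₀ hu0.ne',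
          one_smul, add_sub_cancel]
        exact ⟨hgB, hgh⟩)
    refine ⟨i, hiA, ?_, ⟨e, he, f u, hue, ?_⟩, z, ⟨hzi, ?_⟩, u⁻¹,
      (one_lt_inv₀ hu0).2 (hu.trans ht₂1), hzB, hzh⟩
    · rintro rfl
      exact hg₂ (hbetween i u t₂ 1 hui (hf1 ▸ interior_subset hgB) hu.le ht₂1.le)
    · rw [hfu, add_sub_cancel_left, map_smul, smul_eq_mul]
      exact mul_pos hu0 hgh
    · have h1 : 0 < h (x + u⁻¹ • (z - x) - x) := hzh
      rw [add_sub_cancel_left, map_smul, smul_eq_mul] at h1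
      exact (pos_iff_pos_of_mul_pos h1).1 (inv_pos.2 hu0)
  obtain ⟨u₂, hu₂, e₂, he₂, hue₂⟩ := P.exists_mem_edge_uIcc hfc hgs hg₁
  rw [uIcc_of_ge hs₁.le] at hu₂
  obtain ⟨i₂, hi₂⟩ := D.exists_mem_realEdges he₂
  by_cases hi₂A : i₂ = A
  swap
  · exact key i₂ u₂ (ht₁0.trans_le hu₂.1) (hu₂.2.trans_lt hs₂) ⟨e₂, hi₂, hue₂⟩ hi₂A
  -- The crossing after `t₁` belongs to `A`, so the one before it does not, as `A` would otherwise
  -- contain the exterior point at `t₁`.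
  obtain ⟨u₁, hu₁, e₁, he₁, hue₁⟩ := P.exists_mem_edge_uIcc hfc (hf0.symm ▸ hx) hg₁
  rw [uIcc_of_le ht₁] at hu₁
  obtain ⟨i₁, hi₁⟩ := D.exists_mem_realEdges he₁
  have hi₁A : i₁ ≠ A := by
    rintro rfl
    subst hi₂A
    exact hg₁ (hbetween i₂ u₁ t₁ u₂ (D.subset_body hi₁ hue₁) (D.subset_body hi₂ hue₂)
      hu₁.2 hu₂.1)
  refine key i₁ u₁ (hu₁.1.lt_of_ne ?_) (hu₁.2.trans_lt (hs₁.trans hs₂)) ⟨e₁, hi₁, hue₁⟩ hi₁A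
  rintro rfl
  refine hi₁A (hA i₁ ⟨e₁, hi₁⟩ ?_)
  rw [← hf0]
  exact D.subset_body hi₁ hue₁

end ConvexDecomposition
end HoledPolygon
end KVis

/-! ### Slanted functionals and the placement of the guards -/

namespace KVis

/-- The linear functional `p ↦ p 0 + θ * p 1` on the plane. -/
noncomputable def slant (θ : ℝ) : Plane →L[ℝ] ℝ :=
  EuclideanSpace.proj (0 : Fin 2) + θ • EuclideanSpace.proj (1 : Fin 2)

theorem slant_apply (θ : ℝ) (p : Plane) : slant θ p = p 0 + θ * p 1 := by
  simp [slant]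

theorem plane_ext {p q : Plane} (h0 : p 0 = q 0) (h1 : p 1 = q 1) : p = q := by
  ext i
  fin_cases i
  · exact h0
  · exact h1

theorem norm_plane_le (p : Plane) : ‖p‖ ≤ |p 0| + |p 1| := by
  rw [EuclideanSpace.norm_eq, Fin.sum_univ_two, Real.norm_eq_abs, Real.norm_eq_abs]
  refine Real.sqrt_le_iff.2 ⟨by positivity, ?_⟩
  nlinarith [abs_nonneg (p 0), abs_nonneg (p 1)]

theorem continuous_slant_apply (p : Plane) : Continuous fun θ => slant θ p := by
  simp only [slant_apply]
  fun_prop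

theorem exists_slant_injOn {V : Set Plane} (hV : V.Finite) : ∃ θ, InjOn (slant θ) V := by
  have hfin : (⋃ p ∈ V, ⋃ q ∈ V, {θ | p ≠ q ∧ slant θ p = slant θ q}).Finite := by
    refine hV.biUnion fun p _ => hV.biUnion fun q _ => Set.Subsingleton.finite ?_
    rintro θ ⟨hpq, h⟩ θ' ⟨-, h'⟩
    by_contra hne
    rw [slant_apply, slant_apply] at h h'
    have h1 : (θ - θ') * (p 1 - q 1) = 0 := by linarith
    have h2 : p 1 = q 1 := by
      rcases mul_eq_zero.1 h1 with h3 | h3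
      · exact (hne (sub_eq_zero.1 h3)).elim
      · exact sub_eq_zero.1 h3
    exact hpq (plane_ext (by rw [h2] at h; linarith) h2)
  obtain ⟨θ, hθ⟩ := hfin.infinite_compl.nonempty
  refine ⟨θ, fun p hp q hq h => ?_⟩
  by_contra hpq
  exact hθ (mem_biUnion hp (mem_biUnion hq ⟨hpq, h⟩))

/-- Functionals of two different slopes form a coordinate system, so small values of both force a
small vector; finitely many slopes allow one `δ`. -/
theorem exists_norm_lt_of_abs_slant_le {Θ : Set ℝ} (hΘ : Θ.Finite) {ρ : ℝ} (hρ : 0 < ρ) :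
    ∃ δ > 0, ∀ θ ∈ Θ, ∀ θ' ∈ Θ, θ ≠ θ' → ∀ d : Plane, |slant θ d| ≤ δ → |slant θ' d| ≤ δ →
      ‖d‖ < ρ := by
  have key : ∀ θ ∈ Θ, ∀ θ' ∈ Θ, ∀ᶠ δ in nhdsWithin (0 : ℝ) (Ioi 0), θ ≠ θ' → ∀ d : Plane,
      |slant θ d| ≤ δ → |slant θ' d| ≤ δ → ‖d‖ < ρ := by
    intro θ _ θ' _
    set M := 1 + (|θ| + 1) * (2 / |θ - θ'|) with hM
    have hlim : ∀ᶠ δ in nhdsWithin (0 : ℝ) (Ioi 0), δ * M < ρ := by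
      refine Filter.Eventually.filter_mono nhdsWithin_le_nhds ?_
      exact ((continuous_id.mul continuous_const).continuousAt (x := (0 : ℝ))).eventually_lt
        continuousAt_const (by simpa using hρ)
    filter_upwards [hlim] with δ hδ hne d h h'
    have hpos : 0 < |θ - θ'| := abs_pos.2 (sub_ne_zero.2 hne)
    have h1 : |d 1| ≤ δ * (2 / |θ - θ'|) := by
      rw [← mul_div_assoc, le_div_iff₀ hpos, ← abs_mul]
      have : d 1 * (θ - θ') = slant θ d - slant θ' d := by simp only [slant_apply]; ring
      rw [this]
      linarith [abs_sub (slant θ d) (slant θ' d)]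
    have h0 : |d 0| ≤ δ + |θ| * |d 1| := by
      have : d 0 = slant θ d - θ * d 1 := by rw [slant_apply]; ring
      rw [this, ← abs_mul]
      linarith [abs_sub (slant θ d) (θ * d 1)]
    calc ‖d‖ ≤ |d 0| + |d 1| := norm_plane_le d
      _ ≤ δ + (|θ| + 1) * |d 1| := by linarith
      _ ≤ δ + (|θ| + 1) * (δ * (2 / |θ - θ'|)) := by gcongr
      _ = δ * M := by rw [hM]; ring
      _ < ρ := hδ
  have hall := (Filter.eventually_all_finite hΘ).2 fun θ hθ =>
    (Filter.eventually_all_finite hΘ).2 fun θ' hθ' => key θ hθ θ' hθ'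
  obtain ⟨δ, hδ, hδ0⟩ := (hall.and self_mem_nhdsWithin).exists
  exact ⟨δ, hδ0, hδ⟩

namespace HoledPolygon

variable (P : HoledPolygon)

/-- Small balls about the vertices meet no edges other than those that end there. -/
theorem exists_vertex_radius : ∃ ρ > 0, ∀ v ∈ P.vertices,
    (∀ e ∈ P.edges, (Metric.ball v ρ ∩ e).Nonempty → v ∈ e) ∧
    ∀ w ∈ P.vertices, w ∈ Metric.ball v ρ → w = v := by
  have hsep : ∀ (v : Plane) (K : Set Plane), IsClosed K → v ∉ K →
      ∀ᶠ ρ in nhdsWithin (0 : ℝ) (Ioi 0), ¬ (Metric.ball v ρ ∩ K).Nonempty := by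
    intro v K hK hv
    obtain ⟨r, hr, h⟩ := Metric.isOpen_iff.1 hK.isOpen_compl v hv
    filter_upwards [Ioo_mem_nhdsGT hr] with ρ hρ
    rintro ⟨z, hz, hzK⟩
    exact h (Metric.ball_subset_ball hρ.2.le hz) hzK
  have hall : ∀ᶠ ρ in nhdsWithin (0 : ℝ) (Ioi 0), ∀ v ∈ P.vertices,
      (∀ e ∈ P.edges, (Metric.ball v ρ ∩ e).Nonempty → v ∈ e) ∧
      ∀ w ∈ P.vertices, w ∈ Metric.ball v ρ → w = v := by
    refine (Filter.eventually_all_finite P.finite_vertices).2 fun v _ => .and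
      ((Filter.eventually_all_finite P.finite_edges).2 fun e he => ?_)
      ((Filter.eventually_all_finite P.finite_vertices).2 fun w _ => ?_)
    · by_cases hv : v ∈ e
      · exact Filter.Eventually.of_forall fun _ _ => hv
      · obtain ⟨a, b, -, -, -, rfl⟩ := P.segment_of_mem_edges he
        have hcl : IsClosed (segment ℝ a b) := by
          rw [segment_eq_image_lineMap]
          exact (isCompact_Icc.image AffineMap.lineMap_continuous).isClosed
        exact (hsep v _ hcl hv).mono fun _ h h' => (h h').elim
    · by_cases hw : w = v
      · exact Filter.Eventually.of_forall fun _ _ => hw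
      · exact (hsep v {w} isClosed_singleton (Ne.symm hw)).mono fun _ h h' =>
          (h ⟨w, h', rfl⟩).elim
  obtain ⟨ρ, h, hρ⟩ := (hall.and self_mem_nhdsWithin).exists
  exact ⟨ρ, hρ, h⟩

namespace ConvexDecomposition

variable {P} {C : ℕ} (D : P.ConvexDecomposition C)

/-- The extreme point of the real edges of a piece, and a real edge ending there. -/
theorem exists_extreme_vertex {θ₀ : ℝ} (hθ₀ : InjOn (slant θ₀) P.vertices) {i : Fin C}
    (hi : (D.realEdges i).Nonempty) : ∃ v w, v ≠ w ∧ v ∈ P.vertices ∧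
      segment ℝ v w ∈ D.realEdges i ∧
      ∀ᶠ θ in nhds θ₀, ∀ e ∈ D.realEdges i, ∀ y ∈ e, slant θ v ≤ slant θ y := by
  set V : Set Plane := {p ∈ P.vertices | ∃ e ∈ D.realEdges i, p ∈ e} with hV
  have hVfin : V.Finite := P.finite_vertices.subset (sep_subset _ _)
  have hVne : V.Nonempty := by
    obtain ⟨e, he⟩ := hi
    obtain ⟨a, b, -, ha, -, rfl⟩ := P.segment_of_mem_edges he.1
    exact ⟨a, ha, _, he, left_mem_segment ℝ _ _⟩
  obtain ⟨v, hv, hmin⟩ := V.exists_min_image (slant θ₀) hVfin hVne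
  have hev : ∀ᶠ θ in nhds θ₀, ∀ e ∈ D.realEdges i, ∀ y ∈ e, slant θ v ≤ slant θ y := by
    -- The minimum over the finitely many vertices is strict, hence stable under small changes of
    -- slope.
    have h1 : ∀ᶠ θ in nhds θ₀, ∀ p ∈ V, slant θ v ≤ slant θ p := by
      refine (Filter.eventually_all_finite hVfin).2 fun p hp => ?_
      by_cases hpv : p = v
      · exact Filter.Eventually.of_forall fun _ => by rw [hpv]
      · have hlt : slant θ₀ v < slant θ₀ p :=
          (hmin p hp).lt_of_ne fun h => hpv (hθ₀ hv.1 hp.1 h).symm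
        exact ((continuous_slant_apply v).continuousAt.eventually_lt
          (continuous_slant_apply p).continuousAt hlt).mono fun _ h => h.le
    filter_upwards [h1] with θ hθ e he y hy
    obtain ⟨a, b, -, ha, hb, rfl⟩ := P.segment_of_mem_edges he.1
    have hconv : Convex ℝ {y | slant θ v ≤ slant θ y} :=
      convex_halfSpace_ge (slant θ).toLinearMap.isLinear _
    exact hconv.segment_subset (hθ a ⟨ha, _, he, left_mem_segment ℝ _ _⟩)
      (hθ b ⟨hb, _, he, right_mem_segment ℝ _ _⟩) hy
  obtain ⟨hvP, e, he, hve⟩ := id hv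
  obtain ⟨a, b, hab, ha, hb, rfl⟩ := P.segment_of_mem_edges he.1
  by_cases hva : v = a
  · exact ⟨v, b, hva ▸ hab, hvP, hva ▸ he, hev⟩
  by_cases hvb : v = b
  · exact ⟨v, a, hvb ▸ hab.symm, hvP, by rw [segment_symm, hvb]; exact he, hev⟩
  have hla : slant θ₀ v < slant θ₀ a :=
    (hmin a ⟨ha, _, he, left_mem_segment ℝ _ _⟩).lt_of_ne fun h => hva (hθ₀ hvP ha h)
  have hlb : slant θ₀ v < slant θ₀ b :=
    (hmin b ⟨hb, _, he, right_mem_segment ℝ _ _⟩).lt_of_ne fun h => hvb (hθ₀ hvP hb h)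
  have hconv : Convex ℝ {y | slant θ₀ v < slant θ₀ y} :=
    convex_halfSpace_gt (slant θ₀).toLinearMap.isLinear _
  exact (lt_irrefl (slant θ₀ v) (hconv.segment_subset hla hlb hve)).elim

/-- Guards in groups of `k`, one group for each piece `i` with real edges, on an open real edge of
the piece, within `radius` of its extreme vertex `corner i` with respect to all functionals `slant θ`
for `θ ∈ slopes`. -/
structure GuardPlacement (k : ℕ) where
  corner : Fin C → Plane
  guard : Fin C → Fin k → Plane
  radius : ℝ
  slopes : Finset ℝ
  corner_mem : ∀ i, (D.realEdges i).Nonempty → corner i ∈ P.vertices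
  radius_spec : ∀ i, (D.realEdges i).Nonempty → ∀ e ∈ P.edges,
    (Metric.ball (corner i) radius ∩ e).Nonempty → corner i ∈ e
  guard_mem_ball : ∀ i, (D.realEdges i).Nonempty → ∀ j,
    guard i j ∈ Metric.ball (corner i) radius
  guard_mem_edge : ∀ i, (D.realEdges i).Nonempty → ∀ j, ∃ e ∈ D.realEdges i, guard i j ∈ e
  guard_not_vertex : ∀ i, (D.realEdges i).Nonempty → ∀ j, guard i j ∉ P.vertices
  guard_injective : ∀ i, (D.realEdges i).Nonempty → Function.Injective (guard i)
  card_slopes : slopes.card = C + 1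
  corner_le : ∀ θ ∈ slopes, ∀ i, ∀ e ∈ D.realEdges i, ∀ y ∈ e,
    slant θ (corner i) ≤ slant θ y
  mem_ball_of_split : ∀ i, (D.realEdges i).Nonempty → ∀ θ ∈ slopes, ∀ θ' ∈ slopes, θ ≠ θ' →
    ∀ x j j', slant θ (corner i) ≤ slant θ x → slant θ x ≤ slant θ (guard i j) →
    slant θ' (corner i) ≤ slant θ' x → slant θ' x ≤ slant θ' (guard i j') →
    x ∈ Metric.ball (corner i) radius

/-- The order of choices matters: the slopes near `θ₀`, the radius `ρ`, then `δ` for both, and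
finally `t` so small that guards are within `ρ` of the corner and raise each functional by less than
`δ`. -/
theorem nonempty_guardPlacement (k : ℕ) : Nonempty (D.GuardPlacement k) := by
  classical
  obtain ⟨θ₀, hθ₀⟩ := exists_slant_injOn P.finite_vertices
  have hex : ∀ i, ∃ v w, (D.realEdges i).Nonempty → v ≠ w ∧ v ∈ P.vertices ∧
      segment ℝ v w ∈ D.realEdges i ∧
      ∀ᶠ θ in nhds θ₀, ∀ e ∈ D.realEdges i, ∀ y ∈ e, slant θ v ≤ slant θ y := by
    intro i
    by_cases hi : (D.realEdges i).Nonempty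
    · obtain ⟨v, w, h⟩ := D.exists_extreme_vertex hθ₀ hi
      exact ⟨v, w, fun _ => h⟩
    · exact ⟨0, 0, fun h => (hi h).elim⟩
  choose v w hvw using hex
  have hev : ∀ᶠ θ in nhds θ₀, ∀ i, ∀ e ∈ D.realEdges i, ∀ y ∈ e, slant θ (v i) ≤ slant θ y := by
    refine Filter.eventually_all.2 fun i => ?_
    by_cases hi : (D.realEdges i).Nonempty
    · exact (hvw i hi).2.2.2
    · exact Filter.Eventually.of_forall fun _ e he => (hi ⟨e, he⟩).elim
  obtain ⟨Θ, hΘ, hΘc⟩ := (infinite_of_mem_nhds θ₀ hev).exists_subset_card_eq (C + 1)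
  obtain ⟨ρ, hρ, hρv⟩ := P.exists_vertex_radius
  obtain ⟨δ, hδ, hδΘ⟩ := exists_norm_lt_of_abs_slant_le Θ.finite_toSet hρ
  have hsmall : ∀ᶠ t in nhdsWithin (0 : ℝ) (Ioi 0), t < 1 ∧ ∀ i, t * ‖w i - v i‖ < ρ ∧
      ∀ θ ∈ (Θ : Set ℝ), t * |slant θ (w i - v i)| < δ := by
    have hlim : ∀ c r : ℝ, 0 < r → ∀ᶠ t in nhdsWithin (0 : ℝ) (Ioi 0), t * c < r := by
      intro c r hr
      refine Filter.Eventually.filter_mono nhdsWithin_le_nhds ?_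
      exact ((continuous_id.mul continuous_const).continuousAt (x := (0 : ℝ))).eventually_lt
        continuousAt_const (by simpa using hr)
    refine .and ?_ (Filter.eventually_all.2 fun i => (hlim _ _ hρ).and
      ((Filter.eventually_all_finite Θ.finite_toSet).2 fun θ _ => hlim _ _ hδ))
    simpa using hlim 1 1 one_pos
  obtain ⟨t, ⟨ht1, ht⟩, ht0⟩ := (hsmall.and self_mem_nhdsWithin).exists
  replace ht0 : 0 < t := ht0
  -- `k` distinct positive fractions of the edge, all at most `t`.
  set τ : Fin k → ℝ := fun j => t / (j + 1) with hτ
  have hτ0 : ∀ j, 0 < τ j := fun j => by positivity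
  have hτt : ∀ j, τ j ≤ t := fun j => div_le_self ht0.le (by simp)
  have hτinj : Function.Injective τ := by
    intro j j' h
    have h1 : t / ((j : ℝ) + 1) = t / ((j' : ℝ) + 1) := h
    rw [div_eq_div_iff (by positivity) (by positivity)] at h1
    exact Fin.ext (by exact_mod_cast (add_right_cancel (mul_left_cancel₀ ht0.ne' h1)).symm)
  set g : Fin C → Fin k → Plane := fun i j => v i + τ j • (w i - v i) with hg
  have hball : ∀ i j, g i j ∈ Metric.ball (v i) ρ := by
    intro i j
    rw [mem_ball_iff_norm, hg, add_sub_cancel_left, norm_smul, Real.norm_of_nonneg (hτ0 j).le]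
    exact (mul_le_mul_of_nonneg_right (hτt j) (norm_nonneg _)).trans_lt (ht i).1
  have hslant : ∀ i j, ∀ θ ∈ Θ, slant θ (g i j) ≤ slant θ (v i) + δ := by
    intro i j θ hθ
    simp only [hg, map_add, map_smul, smul_eq_mul]
    have h1 := (ht i).2 θ hθ
    have h2 : τ j * slant θ (w i - v i) ≤ t * |slant θ (w i - v i)| :=
      (mul_le_mul_of_nonneg_left (le_abs_self _) (hτ0 j).le).trans
        (mul_le_mul_of_nonneg_right (hτt j) (abs_nonneg _))
    linarith
  refine ⟨{ corner := v, guard := g, radius := ρ, slopes := Θ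
            corner_mem := fun i hi => (hvw i hi).2.1
            radius_spec := fun i hi => (hρv _ (hvw i hi).2.1).1
            guard_mem_ball := fun i _ j => hball i j
            guard_mem_edge := fun i hi j => ⟨_, (hvw i hi).2.2.1, ?_⟩
            guard_not_vertex := fun i hi j hP => ?_
            guard_injective := fun i hi j j' h => ?_
            card_slopes := hΘc
            corner_le := fun θ hθ => hΘ hθ
            mem_ball_of_split := fun i hi θ hθ θ' hθ' hne x j j' h1 h2 h3 h4 => ?_ }⟩
  · rw [segment_eq_image']
    exact ⟨τ j, ⟨(hτ0 j).le, (hτt j).trans ht1.le⟩, rfl⟩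
  · have h := (hρv _ (hvw i hi).2.1).2 _ hP (hball i j)
    rw [hg, add_eq_left, smul_eq_zero, sub_eq_zero] at h
    rcases h with h | h
    · exact (hτ0 j).ne' h
    · exact (hvw i hi).1 h.symm
  · have h' : τ j • (w i - v i) = τ j' • (w i - v i) := add_left_cancel h
    exact hτinj (smul_left_injective ℝ (sub_ne_zero.2 (hvw i hi).1.symm) h')
  · rw [mem_ball_iff_norm]
    refine hδΘ θ hθ θ' hθ' hne _ ?_ ?_
    · have := hslant i j θ hθ
      rw [map_sub, abs_le]
      constructor <;> linarith
    · have := hslant i j' θ' hθ'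
      rw [map_sub, abs_le]
      constructor <;> linarith

end ConvexDecomposition
end HoledPolygon
end KVis

/-! ### Two fully visible groups for every point -/

namespace KVis
namespace HoledPolygon
namespace ConvexDecomposition
namespace GuardPlacement

variable {P : HoledPolygon} {C : ℕ} {D : P.ConvexDecomposition C} {k : ℕ}
  (g : D.GuardPlacement k)

theorem guard_mem_body {i : Fin C} (hi : (D.realEdges i).Nonempty) (j : Fin k) :
    g.guard i j ∈ D.body i := by
  obtain ⟨e, he, h⟩ := g.guard_mem_edge i hi j
  exact D.subset_body he h

theorem kVisible_of_mem_body {i : Fin C} (hi : (D.realEdges i).Nonempty) {x : Plane}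
    (hx : x ∈ D.body i) (j : Fin k) : P.KVisible k (g.guard i j) x :=
  kVisible_of_segment_subset
    (((D.convex i).segment_subset (g.guard_mem_body hi j) hx).trans (D.body_subset_region i))

theorem kVisible_of_mem_ball (hk : 2 ≤ k) {i : Fin C} (hi : (D.realEdges i).Nonempty) {x : Plane}
    (hxP : x ∈ P.region) (hx : x ∈ Metric.ball (g.corner i) g.radius) (j : Fin k) :
    P.KVisible k (g.guard i j) x :=
  HoledPolygon.kVisible_of_mem_ball hk (g.corner_mem i hi) (g.radius_spec i hi)
    (g.guard_mem_ball i hi j) hx (D.body_subset_region i (g.guard_mem_body hi j)) hxP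

/-- Among the pieces of a family with guards in an open half plane bounded by a line through `x`, a
piece with no other one in front of it has all its guards visible from `x`. -/
theorem exists_kVisible_of_half_plane (hk : 2 ≤ k) {x : Plane} (hx : x ∈ P.region) {A : Fin C}
    (hA : ∀ i, (D.realEdges i).Nonempty → x ∈ D.body i → i = A)
    (h m : Plane →L[ℝ] ℝ) (hinj : ∀ d, h d = 0 → m d = 0 → d = 0) {w : Plane} (hw : h w = 0)
    (hmw : m w = 1) (F : Finset (Fin C)) (hF : F.Nonempty)
    (hreal : ∀ i ∈ F, (D.realEdges i).Nonempty)
    (hpos : ∀ i ∈ F, ∀ j, 0 < h (g.guard i j - x))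
    (hclosed : ∀ i, i ≠ A → ∀ e ∈ D.realEdges i, ∀ y ∈ e, 0 < h (y - x) → i ∈ F) :
    ∃ i ∈ F, ∀ j, P.KVisible k (g.guard i j) x := by
  have hopen : IsOpen {p : Plane | 0 < h (p - x)} :=
    isOpen_lt continuous_const (h.continuous.comp (continuous_id.sub continuous_const))
  have hconv : Convex ℝ {p : Plane | 0 < h (p - x)} := by
    simp only [map_sub, sub_pos]
    exact convex_halfSpace_gt h.toLinearMap.isLinear _
  obtain ⟨i, hi, hmin⟩ := exists_forall_not_inFront (x := x) h m hinj hw hmw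
    (fun i => interior (D.body i) ∩ {p | 0 < h (p - x)}) F hF
    (fun i _ => isOpen_interior.inter hopen) (fun i _ => (D.convex i).interior.inter hconv)
    (fun i hi => by
      obtain ⟨z, hz, hzi⟩ := mem_closure_iff.1 (D.body_subset_closure_interior i
        (g.guard_mem_body (hreal i hi) ⟨0, by omega⟩)) _ hopen (hpos i hi _)
      exact ⟨z, hzi, hz⟩)
    (fun i _ p hp => hp.2)
    (fun i _ j _ hij => (D.disjoint_interior_body hij).mono inter_subset_left inter_subset_left)
  refine ⟨i, hi, fun j => ?_⟩
  by_contra hvis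
  obtain ⟨l, hlA, hli, ⟨e, he, y, hy, hyh⟩, hfront⟩ := D.exists_inFront_of_not_kVisible hk hx hA
    (g.guard_mem_body (hreal i hi) j) hvis h (hpos i hi j)
  exact hmin l (hclosed l hlA e he y hy hyh) hli hfront

/-- For each point there is a functional such that no group of guards has points on both sides, with
the exception of the groups with corner near the point. -/
theorem exists_slope (x : Plane) : ∃ θ ∈ g.slopes, ∀ i, (D.realEdges i).Nonempty →
    x ∉ Metric.ball (g.corner i) g.radius → ∀ j, slant θ (g.corner i) ≤ slant θ x →
    slant θ (g.guard i j) < slant θ x := by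
  by_contra! hcon
  have : Nonempty (Fin C) := by
    obtain ⟨θ, hθ⟩ := Finset.card_pos.1 (by rw [g.card_slopes]; omega)
    exact ⟨(hcon θ hθ).choose⟩
  choose! f hf using hcon
  -- With `C + 1` slopes and `C` pieces, two slopes fail on the same piece; both functionals then
  -- pin `x` near its corner.
  obtain ⟨θ, hθ, θ', hθ', hne, heq⟩ := Finset.exists_ne_map_eq_of_card_lt_of_maps_to
    (s := g.slopes) (t := Finset.univ) (f := f) (by rw [g.card_slopes]; simp)
    (fun _ _ => Finset.mem_univ _)
  obtain ⟨h1, h2, j, h3, h4⟩ := hf θ hθ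
  obtain ⟨-, -, j', h5, h6⟩ := hf θ' hθ'
  rw [← heq] at h5 h6
  exact h2 (g.mem_ball_of_split _ h1 θ hθ θ' hθ' hne x j j' h3 h4 h5 h6)

theorem exists_kVisible (hk : 2 ≤ k) (hP : ¬ Convex ℝ P.region) {x : Plane} (hx : x ∈ P.region)
    {A : Fin C} (hA : ∀ i, (D.realEdges i).Nonempty →
      x ∈ D.body i ∨ x ∈ Metric.ball (g.corner i) g.radius → i = A) :
    ∃ i, (D.realEdges i).Nonempty ∧ i ≠ A ∧ ∀ j, P.KVisible k (g.guard i j) x := by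
  classical
  obtain ⟨θ, hθ, hsplit⟩ := g.exists_slope x
  replace hsplit : ∀ i, (D.realEdges i).Nonempty → i ≠ A → ∀ j,
      slant θ (g.corner i) ≤ slant θ x → slant θ (g.guard i j) < slant θ x :=
    fun i hi hiA => hsplit i hi fun h => hiA (hA i hi (Or.inr h))
  set F := Finset.univ.filter fun i => (D.realEdges i).Nonempty ∧ i ≠ A with hF
  have hmem : ∀ i, i ∈ F ↔ (D.realEdges i).Nonempty ∧ i ≠ A := by simp [hF]
  suffices h : ∃ i ∈ F, ∀ j, P.KVisible k (g.guard i j) x by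
    obtain ⟨i, hi, h⟩ := h
    exact ⟨i, ((hmem i).1 hi).1, ((hmem i).1 hi).2, h⟩
  have hinj : ∀ d : Plane, slant θ d = 0 → (EuclideanSpace.proj 1 : Plane →L[ℝ] ℝ) d = 0 →
      d = 0 := by
    intro d h0 h1
    rw [slant_apply] at h0
    replace h1 : d 1 = 0 := h1
    exact plane_ext (by simpa [h1] using h0) h1
  have hw : slant θ !₂[-θ, 1] = 0 := by simp [slant_apply]
  have hmw : (EuclideanSpace.proj 1 : Plane →L[ℝ] ℝ) !₂[-θ, 1] = 1 := by simp
  by_cases hleft : ∃ i ∈ F, slant θ (g.corner i) < slant θ x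
  · obtain ⟨i₀, hi₀, hi₀x⟩ := hleft
    obtain ⟨i, hi, h⟩ := g.exists_kVisible_of_half_plane hk hx
      (fun i hi hxi => hA i hi (Or.inl hxi)) (-slant θ) (EuclideanSpace.proj 1)
      (fun d hd => hinj d (by simpa using hd)) (w := !₂[-θ, 1])
      (by rw [neg_apply, hw, neg_zero]) hmw
      (F.filter fun i => slant θ (g.corner i) < slant θ x) ⟨i₀, Finset.mem_filter.2 ⟨hi₀, hi₀x⟩⟩
      (fun i hi => ((hmem i).1 (Finset.mem_filter.1 hi).1).1)
      (fun i hi j => by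
        obtain ⟨hiF, hix⟩ := Finset.mem_filter.1 hi
        have := hsplit i ((hmem i).1 hiF).1 ((hmem i).1 hiF).2 j hix.le
        rw [neg_apply, map_sub]
        linarith)
      (fun i hiA e he y hy hyx => by
        have := g.corner_le θ hθ i e he y hy
        rw [neg_apply, map_sub] at hyx
        exact Finset.mem_filter.2 ⟨(hmem i).2 ⟨⟨e, he⟩, hiA⟩, by linarith⟩)
    exact ⟨i, (Finset.mem_filter.1 hi).1, h⟩
  · push Not at hleft
    obtain ⟨B, hBA, hB⟩ := D.exists_realEdges_nonempty_ne hP A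
    refine g.exists_kVisible_of_half_plane hk hx
      (fun i hi hxi => hA i hi (Or.inl hxi)) (slant θ) (EuclideanSpace.proj 1)
      hinj hw hmw F ⟨B, (hmem B).2 ⟨hB, hBA⟩⟩
      (fun i hi => ((hmem i).1 hi).1) (fun i hi j => ?_)
      (fun i hiA e he _ _ _ => (hmem i).2 ⟨⟨e, he⟩, hiA⟩)
    obtain ⟨hir, hiA⟩ := (hmem i).1 hi
    obtain ⟨e, he, hge⟩ := g.guard_mem_edge i hir j
    have h1 := g.corner_le θ hθ i e he _ hge
    -- Equality is impossible: the guards would lie strictly below `x`, but they are never below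
    -- their corner.
    have h2 : slant θ x < slant θ (g.corner i) := (hleft i hi).lt_of_ne fun h =>
      absurd (hsplit i hir hiA j h.ge) (by linarith)
    rw [map_sub]
    linarith

/-- Each point sees all the guards of two groups. -/
theorem exists_two_kVisible (hk : 2 ≤ k) (hP : ¬ Convex ℝ P.region) {x : Plane}
    (hx : x ∈ P.region) : ∃ A B, A ≠ B ∧ (D.realEdges A).Nonempty ∧ (D.realEdges B).Nonempty ∧
      (∀ j, P.KVisible k (g.guard A j) x) ∧ ∀ j, P.KVisible k (g.guard B j) x := by
  set Z : Set (Fin C) := {i | (D.realEdges i).Nonempty ∧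
    (x ∈ D.body i ∨ x ∈ Metric.ball (g.corner i) g.radius)} with hZ
  have hvis : ∀ i ∈ Z, ∀ j, P.KVisible k (g.guard i j) x := by
    rintro i ⟨hi, h | h⟩ j
    · exact g.kVisible_of_mem_body hi h j
    · exact g.kVisible_of_mem_ball hk hi hx h j
  by_cases hne : Z.Nonempty
  · obtain ⟨A, hA⟩ := hne
    by_cases hAZ : ∀ i ∈ Z, i = A
    · obtain ⟨B, hB, hBA, h⟩ := g.exists_kVisible hk hP hx fun i hi h => hAZ i ⟨hi, h⟩
      exact ⟨A, B, hBA.symm, hA.1, hB, hvis A hA, h⟩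
    · push Not at hAZ
      obtain ⟨B, hB, hBA⟩ := hAZ
      exact ⟨A, B, hBA.symm, hA.1, hB.1, hvis A hA, hvis B hB⟩
  · have hZe : ∀ i, (D.realEdges i).Nonempty →
        ¬ (x ∈ D.body i ∨ x ∈ Metric.ball (g.corner i) g.radius) :=
      fun i hi h => hne ⟨i, hi, h⟩
    -- The index excluded in the first application is arbitrary, since no group is close to `x`; the
    -- second application excludes the group just found.
    obtain ⟨i₀, -⟩ : ∃ i, x ∈ D.body i := mem_iUnion.1 (D.cover.symm ▸ hx)
    obtain ⟨A, hA, -, hvA⟩ := g.exists_kVisible (A := i₀) hk hP hx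
      fun i hi h => (hZe i hi h).elim
    obtain ⟨B, hB, hBA, hvB⟩ := g.exists_kVisible (A := A) hk hP hx
      fun i hi h => (hZe i hi h).elim
    exact ⟨A, B, hBA.symm, hA, hB, hvA, hvB⟩

theorem guard_ne {i i' : Fin C} (hi : (D.realEdges i).Nonempty) (hi' : (D.realEdges i').Nonempty)
    (h : i ≠ i') (j j' : Fin k) : g.guard i j ≠ g.guard i' j' := by
  intro heq
  obtain ⟨e, he, hge⟩ := g.guard_mem_edge i hi j
  obtain ⟨e', he', hge'⟩ := g.guard_mem_edge i' hi' j'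
  have := P.edge_eq_of_mem he.1 he'.1 hge (heq ▸ hge') (g.guard_not_vertex i hi j)
  exact h (D.eq_of_mem_realEdges he (this ▸ he'))

end GuardPlacement
end ConvexDecomposition
end HoledPolygon
end KVis

/-- If a non-convex polygon, possibly with holes, is decomposed into `C` convex pieces, then at most
`k * C` guards on its edges suffice to `(k + 2)`-guard it under `k`-visibility. -/
theorem mainTheorem3 (P : KVis.HoledPolygon) (hP : ¬ Convex ℝ P.region)
    (k : ℕ) (hk : Even k) (hk2 : 2 ≤ k) (C : ℕ) (D : P.ConvexDecomposition C) :
    ∃ G : Finset KVis.Plane, G.card ≤ k * C ∧ P.MGuards (k + 2) k G := by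
  classical
  obtain ⟨g⟩ := D.nonempty_guardPlacement k
  refine ⟨((Finset.univ.filter fun i => (D.realEdges i).Nonempty) ×ˢ Finset.univ).image
    fun q => g.guard q.1 q.2, ?_, ?_, ?_⟩
  · refine Finset.card_image_le.trans ?_
    rw [Finset.card_product, Finset.card_univ, Fintype.card_fin, mul_comm]
    exact Nat.mul_le_mul_left k ((Finset.card_le_univ _).trans (Fintype.card_fin C).le)
  · intro p hp
    obtain ⟨⟨i, j⟩, hq, rfl⟩ := Finset.mem_image.1 hp
    simp only [Finset.mem_product, Finset.mem_filter, Finset.mem_univ, true_and, and_true] at hq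
    obtain ⟨e, he, hge⟩ := g.guard_mem_edge i hq j
    exact ⟨e, he.1, hge⟩
  · intro x hx
    obtain ⟨A, B, hAB, hA, hB, hvA, hvB⟩ := g.exists_two_kVisible hk2 hP hx
    have hcard : ∀ i, (D.realEdges i).Nonempty →
        (Set.range (g.guard i)).encard = k := fun i hi => by
      rw [← Set.image_univ, (g.guard_injective i hi).encard_image, Set.encard_univ]
      simp
    have hdisj : Disjoint (Set.range (g.guard A)) (Set.range (g.guard B)) := by
      rw [Set.disjoint_left]
      rintro _ ⟨j, rfl⟩ ⟨j', h⟩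
      exact g.guard_ne hA hB hAB j j' h.symm
    calc ((k + 2 : ℕ) : ℕ∞) ≤ ((k + k : ℕ) : ℕ∞) := by exact_mod_cast Nat.add_le_add_left hk2 k
      _ = (Set.range (g.guard A) ∪ Set.range (g.guard B)).encard := by
        rw [Set.encard_union_eq hdisj, hcard A hA, hcard B hB]
        push_cast
        rfl
      _ ≤ _ := by
        refine Set.encard_le_encard ?_
        have hG : ∀ i, (D.realEdges i).Nonempty → ∀ j, g.guard i j ∈
            ((Finset.univ.filter fun i => (D.realEdges i).Nonempty) ×ˢ Finset.univ).image
              fun q : Fin C × Fin k => g.guard q.1 q.2 := fun i hi j =>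
          Finset.mem_image.2 ⟨(i, j), by simpa using hi, rfl⟩
        rintro _ (⟨j, rfl⟩ | ⟨j, rfl⟩)
        · exact ⟨hG A hA j, hvA j⟩
        · exact ⟨hG B hB j, hvB j⟩
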